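/- A double Boolean algebra (dBa) is an algebra $\mathbf D=(D,\sqcup,\sqcap,\neg,\lrcorner,\top,\bot)$ of type $(2,2,1,1,0,0)$ such that, writing $x\vee y:=\neg(\neg x\sqcap\neg y)$ and $x\wedge y:=\lrcorner(\lrcorner x\sqcup\lrcorner y)$, the following hold for all $x,y,z\in D$: (1a) $(x\sqcap x)\sqcap y=x\sqcap y$; (2a) $x\sqcap y=y\sqcap x$; (3a) $x\sqcap(y\sqcap z)=(x\sqcap y)\sqcap z$; (4a) $\neg(x\sqcap x)=\neg x$; (5a) $x\sqcap(x\sqcup y)=x\sqcap x$; (6a) $x\sqcap(y\vee z)=(x\sqcap y)\vee(x\sqcap z)$; (7a) $x\sqcap(x\vee y)=x\sqcap x$; (8a) $\neg\neg(x\sqcap y)=x\sqcap y$; (9a) $x\sqcap\neg x=\bot$; (10a) $\neg\bot=\top\sqcap\top$; (11a) $\neg\top=\bot$; (1b)--(11b), the duals of (1a)--(11a) obtained by exchanging $\sqcap$ with $\sqcup$, $\neg$ with $\lrcorner$, $\vee$ with $\wedge$, and $\top$ with $\bot$; and (12) $(x\sqcap x)\sqcup(x\sqcap x)=(x\sqcup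 x)\sqcap(x\sqcup x)$. Put $x\sqsubseteq y$ iff $x\sqcap y=x\sqcap x$ and $x\sqcup y=y\sqcup y$. The dBa $\mathbf D$ is fully contextual if $\sqsubseteq$ is a partial order on $D$ and for all $y,x\in D$ with $y\sqcap y=y$, $x\sqcup x=x$ and $y\sqcup y=x\sqcap x$ there is a unique $z\in D$ with $z\sqcap z=y$ and $z\sqcup z=x$. A dBa isomorphism is a bijection preserving $\sqcup,\sqcap,\neg,\lrcorner,\top,\bot$. Let $\mathbf{FCDBA}$ be the category whose objects are the fully contextual dBas and whose morphisms are the dBa isomorphisms. Let $(G,\rho)$ and $(M,\tau)$ be topological spaces and $R\subseteq G\times M$. For $g\in G$ put $R(g)=\{m\in M: gRm\}$ and for $m\in M$ put $R^{-1}(m)=\{g\in G: gRm\}$. The relation $R$ is continuous if for every $g_0\in G$ and every open $O\subseteq M$: if $R(g_0)\cap O\neq\emptyset$, then $R(g)\cap O\neq\emptyset$ for all $g$ in some neighbourhood of $g_0$; and if $R(g_0)\subseteq O$, then $R(g)\subseteq O$ for all $g$ in some neighbourhood of $g_0$. Continuity of the converse $R^{-1}\subseteq M\times G$ is defined in the same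 way. A pair $(A,B)$ with $A\subseteq G$ and $B\subseteq M$ is a clopen object oriented semiconcept if $A$ and $B$ are clopen and either $B=\{m\in M: R^{-1}(m)\subseteq A\}$ or $A=\{g\in G: R(g)\cap B\neq\emptyset\}$. A Stone space is a compact space in which any two distinct points can be separated by a clopen set. The triple $\mathbb K^T=((G,\rho),(M,\tau),R)$ is a Stone context if $R$ and $R^{-1}$ are continuous, $(G,\rho)$ and $(M,\tau)$ are Stone spaces, and $gRm$ holds whenever $g\in G$, $m\in M$ are such that for every clopen object oriented semiconcept $(A,B)$, $m\in B$ implies $g\in A$. A CTSCR-homeomorphism from $((G_1,\rho_1),(M_1,\tau_1),R_1)$ to $((G_2,\rho_2),(M_2,\tau_2),R_2)$ is a pair $(\alpha,\beta)$ of homeomorphisms $\alpha:G_1\to G_2$, $\beta:M_1\to M_2$ such that $gR_1m\iff\alpha(g)R_2\beta(m)$ for all $g\in G_1$, $m\in M_1$. Let $\mathbf{Scxt}$ be the category whose objects are the Stone contexts and whose morphisms are the CTSCR-homeomorphisms, with componentwise composition. Theorem. $\mathbf{FCDBA}$ is dually equivalent to $\mathbf{Scxt}$; that is, the categories $\mathbf{FCDBA}^{\mathrm{op}}$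 and $\mathbf{Scxt}$ are equivalent. -/

import Mathlib

open CategoryTheory

universe u v

namespace DBA

/-! ### Double Boolean algebras -/

/-- The operations of a double Boolean algebra, an algebra of type `(2,2,1,1,0,0)`.
`x ⊓ y` and `x ⊔ y` are the two binary operations, `xᶜ` is the negation `¬ x`, `￢x` is the second
negation `⌟ x`, and `⊤`, `⊥` are the constants. No order and no lattice law is presupposed. -/
class DBAOps (D : Type u) extends Min D, Max D, Compl D, HNot D, Top D, Bot D

section Ops

variable {D : Type u} [DBAOps D]

/-- `x ∨ y := ¬(¬x ⊓ ¬y)`. -/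
def vee (x y : D) : D := (xᶜ ⊓ yᶜ)ᶜ

/-- `x ∧ y := ⌟(⌟x ⊔ ⌟y)`. -/
def wedge (x y : D) : D := ￢(￢x ⊔ ￢y)

/-- The quasi-order `x ⊑ y`. -/
def QLE (x y : D) : Prop := x ⊓ y = x ⊓ x ∧ x ⊔ y = y ⊔ y

end Ops

/-- Double Boolean algebras (dBas). -/
class DoubleBooleanAlgebra (D : Type u) extends DBAOps D where
  ax1a : ∀ x y : D, (x ⊓ x) ⊓ y = x ⊓ y
  ax2a : ∀ x y : D, x ⊓ y = y ⊓ x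
  ax3a : ∀ x y z : D, x ⊓ (y ⊓ z) = (x ⊓ y) ⊓ z
  ax4a : ∀ x : D, (x ⊓ x)ᶜ = xᶜ
  ax5a : ∀ x y : D, x ⊓ (x ⊔ y) = x ⊓ x
  ax6a : ∀ x y z : D, x ⊓ vee y z = vee (x ⊓ y) (x ⊓ z)
  ax7a : ∀ x y : D, x ⊓ vee x y = x ⊓ x
  ax8a : ∀ x y : D, (x ⊓ y)ᶜᶜ = x ⊓ y
  ax9a : ∀ x : D, x ⊓ xᶜ = ⊥
  ax10a : (⊥ : D)ᶜ = ⊤ ⊓ ⊤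
  ax11a : (⊤ : D)ᶜ = ⊥
  ax1b : ∀ x y : D, (x ⊔ x) ⊔ y = x ⊔ y
  ax2b : ∀ x y : D, x ⊔ y = y ⊔ x
  ax3b : ∀ x y z : D, x ⊔ (y ⊔ z) = (x ⊔ y) ⊔ z
  ax4b : ∀ x : D, ￢(x ⊔ x) = ￢x
  ax5b : ∀ x y : D, x ⊔ (x ⊓ y) = x ⊔ x
  ax6b : ∀ x y z : D, x ⊔ wedge y z = wedge (x ⊔ y) (x ⊔ z)
  ax7b : ∀ x y : D, x ⊔ wedge x y = x ⊔ x
  ax8b : ∀ x y : D, ￢￢(x ⊔ y) = x ⊔ y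
  ax9b : ∀ x : D, x ⊔ ￢x = ⊤
  ax10b : ￢(⊤ : D) = ⊥ ⊔ ⊥
  ax11b : ￢(⊥ : D) = ⊤
  ax12 : ∀ x : D, (x ⊓ x) ⊔ (x ⊓ x) = (x ⊔ x) ⊓ (x ⊔ x)

/-- A dBa is contextual if its quasi-order `⊑` is a partial order. -/
def IsContextual (D : Type u) [DoubleBooleanAlgebra D] : Prop :=
  IsPartialOrder D QLE

/-- A dBa is fully contextual if it is contextual and, for each `y ∈ D_⊓` and `x ∈ D_⊔` with
`y_⊔ = x_⊓`, there is a unique `z` with `z_⊓ = y` and `z_⊔ = x`. -/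
def IsFullyContextual (D : Type u) [DoubleBooleanAlgebra D] : Prop :=
  IsContextual D ∧
    ∀ y x : D, y ⊓ y = y → x ⊔ x = x → y ⊔ y = x ⊓ x → ∃! z : D, z ⊓ z = y ∧ z ⊔ z = x

/-- dBa homomorphisms. -/
structure IsDBAHom {D : Type u} {E : Type v} [DoubleBooleanAlgebra D] [DoubleBooleanAlgebra E]
    (h : D → E) : Prop where
  map_inf : ∀ a b : D, h (a ⊓ b) = h a ⊓ h b
  map_sup : ∀ a b : D, h (a ⊔ b) = h a ⊔ h b
  map_compl : ∀ a : D, h aᶜ = (h a)ᶜ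
  map_hnot : ∀ a : D, h (￢a) = ￢(h a)
  map_top : h ⊤ = ⊤
  map_bot : h ⊥ = ⊥

/-- dBa isomorphisms: bijective dBa homomorphisms. -/
@[ext]
structure DBAIso (D : Type u) (E : Type v) [DoubleBooleanAlgebra D] [DoubleBooleanAlgebra E] where
  toFun : D → E
  isHom : IsDBAHom toFun
  bijective : Function.Bijective toFun

/-- The identity dBa isomorphism. -/
def DBAIso.refl (D : Type u) [DoubleBooleanAlgebra D] : DBAIso D D where
  toFun := id
  isHom := ⟨fun _ _ => rfl, fun _ _ => rfl, fun _ => rfl, fun _ => rfl, rfl, rfl⟩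
  bijective := Function.bijective_id

/-- Composition of dBa isomorphisms (first `f`, then `g`). -/
def DBAIso.trans {D E F : Type u} [DoubleBooleanAlgebra D] [DoubleBooleanAlgebra E]
    [DoubleBooleanAlgebra F] (f : DBAIso D E) (g : DBAIso E F) : DBAIso D F where
  toFun := g.toFun ∘ f.toFun
  isHom :=
    { map_inf := fun a b => by simp [f.isHom.map_inf, g.isHom.map_inf]
      map_sup := fun a b => by simp [f.isHom.map_sup, g.isHom.map_sup]
      map_compl := fun a => by simp [f.isHom.map_compl, g.isHom.map_compl]
      map_hnot := fun a => by simp [f.isHom.map_hnot, g.isHom.map_hnot]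
      map_top := by simp [f.isHom.map_top, g.isHom.map_top]
      map_bot := by simp [f.isHom.map_bot, g.isHom.map_bot] }
  bijective := g.bijective.comp f.bijective

/-- The objects of **FCDBA**: fully contextual dBas. -/
structure FCDBA : Type (u + 1) where
  carrier : Type u
  [dba : DoubleBooleanAlgebra carrier]
  fullyContextual : IsFullyContextual carrier

attribute [instance] FCDBA.dba

/-- The category **FCDBA**: morphisms are the dBa isomorphisms. -/
instance : Category.{u} FCDBA.{u} where
  Hom D E := DBAIso D.carrier E.carrier
  id D := DBAIso.refl D.carrier
  comp f g := f.trans g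

/-! ### Contexts on topological spaces -/

/-- A context on topological spaces (CTS): two topological spaces `(G, ρ)` (objects) and `(M, τ)`
(properties) with a relation `R ⊆ G × M`. -/
structure CTS : Type (u + 1) where
  G : Type u
  M : Type u
  [topG : TopologicalSpace G]
  [topM : TopologicalSpace M]
  R : G → M → Prop

attribute [instance] CTS.topG CTS.topM

namespace CTS

variable (K : CTS.{u})

/-- `B^◇ = {g | R(g) ∩ B ≠ ∅}`. -/
def diamond (B : Set K.M) : Set K.G := {g | ({m | K.R g m} ∩ B).Nonempty}

/-- `A^■ = {m | R⁻¹(m) ⊆ A}`. -/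
def blackBox (A : Set K.G) : Set K.M := {m | {g | K.R g m} ⊆ A}

/-- Object oriented semiconcepts `(A, B)`. -/
def IsSemiconcept (A : Set K.G) (B : Set K.M) : Prop :=
  K.blackBox A = B ∨ K.diamond B = A

/-- Clopen object oriented semiconcepts. -/
def IsClopenSemiconcept (A : Set K.G) (B : Set K.M) : Prop :=
  K.IsSemiconcept A B ∧ IsClopen A ∧ IsClopen B

end CTS

/-- A relation `R ⊆ X × Y`, viewed as the many-valued map `x ↦ R(x)`, is continuous if it is both
lower and upper semi-continuous at every point (in Mathlib, semi-continuity of many-valued maps is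
called hemicontinuity). -/
def RelContinuous {X : Type u} {Y : Type v} [TopologicalSpace X] [TopologicalSpace Y]
    (R : X → Y → Prop) : Prop :=
  LowerHemicontinuous (fun x => {y | R x y}) ∧ UpperHemicontinuous (fun x => {y | R x y})

/-- A CTSCR: a CTS in which both `R` and its converse are continuous. -/
structure IsCTSCR (K : CTS.{u}) : Prop where
  continuous : RelContinuous K.R
  continuous_conv : RelContinuous (fun (m : K.M) (g : K.G) => K.R g m)

/-- A Stone space: a compact space in which any two distinct points are separated by a clopen
set. -/
def IsStoneSpace (X : Type u) [TopologicalSpace X] : Prop :=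
  CompactSpace X ∧ ∀ x y : X, x ≠ y → ∃ U : Set X, IsClopen U ∧ x ∈ U ∧ y ∉ U

/-- Stone contexts. -/
structure IsStoneContext (K : CTS.{u}) : Prop extends IsCTSCR K where
  stoneG : IsStoneSpace K.G
  stoneM : IsStoneSpace K.M
  rel_of_semiconcepts : ∀ (g : K.G) (m : K.M),
    (∀ (A : Set K.G) (B : Set K.M), K.IsClopenSemiconcept A B → m ∈ B → g ∈ A) → K.R g m

/-- CTS-homeomorphisms (called CTSCR-homeomorphisms between CTSCRs): pairs `(α, β)` of
homeomorphisms with `g R₁ m ↔ α(g) R₂ β(m)`. -/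
@[ext]
structure CTSHomeo (K L : CTS.{u}) where
  α : K.G ≃ₜ L.G
  β : K.M ≃ₜ L.M
  rel_iff : ∀ (g : K.G) (m : K.M), K.R g m ↔ L.R (α g) (β m)

/-- The identity CTS-homeomorphism. -/
def CTSHomeo.refl (K : CTS.{u}) : CTSHomeo K K where
  α := Homeomorph.refl K.G
  β := Homeomorph.refl K.M
  rel_iff := fun _ _ => Iff.rfl

/-- Componentwise composition of CTS-homeomorphisms (first `f`, then `g`). -/
def CTSHomeo.trans {K L N : CTS.{u}} (f : CTSHomeo K L) (g : CTSHomeo L N) : CTSHomeo K N where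
  α := f.α.trans g.α
  β := f.β.trans g.β
  rel_iff := fun x y => (f.rel_iff x y).trans (g.rel_iff (f.α x) (f.β y))

/-- The objects of **Scxt**: Stone contexts. -/
structure Scxt : Type (u + 1) where
  cts : CTS.{u}
  isStone : IsStoneContext cts

/-- The category **Scxt**: morphisms are the CTSCR-homeomorphisms. -/
instance : Category.{u} Scxt.{u} where
  Hom K L := CTSHomeo K.cts L.cts
  id K := CTSHomeo.refl K.cts
  comp f g := f.trans g

end DBA

namespace DBA

/-! ### Algebra in a double Boolean algebra -/

section Algebra

variable {D : Type u} [DoubleBooleanAlgebra D]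

open DoubleBooleanAlgebra

/-! This is Stone duality on two sides, glued along a relation. A Stone context yields the algebra
of pairs (A, B) of clopen sets with A^■◇ = B^◇, and a homeomorphism of contexts acts on it by
inverse image. The resulting contravariant functor `algebraFunctor` is shown to be faithful, full
and essentially surjective.

Faithful and full: the operations ⊓, ᶜ see only extents and ⊔, ￢ only intents, and every clopen set
occurs as an extent and as an intent. An isomorphism therefore induces order isomorphisms of both
clopen algebras, hence two homeomorphisms (`exists_homeomorph_of_clopens`). These respect R because
in a Stone context R is determined by the protoconcepts (`rel_iff_forall_protoconcept`).

Essentially surjective: the idempotents of ⊓ in D form a Boolean algebra, and dually those of ⊔.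
Their Stone spaces, with g R m when m is true wherever g is, form a Stone context, and x is sent to
the pair of sets of points at which x is false. The prime ideal theorem gives
`MeetPoint.exists_joinPoint` and its dual, which identify ◇ with x ↦ x ⊔ x and ■ with x ↦ x ⊓ x
(`diamond_intentOf`, `blackBox_extentOf`). Axiom (12) then makes the image a protoconcept.
Contextuality gives injectivity, and the gluing condition of full contextuality gives surjectivity.
-/

lemma inf_inf_self_right (x y : D) : x ⊓ (y ⊓ y) = x ⊓ y := by
  rw [ax2a x (y ⊓ y), ax1a, ax2a]

lemma inf_mem_meetPart (x y : D) : (x ⊓ y) ⊓ (x ⊓ y) = x ⊓ y := by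
  rw [ax3a (x ⊓ y) x y, ax2a (x ⊓ y) x, ax3a x x y, ax1a, ← ax3a, inf_inf_self_right]

lemma compl_compl_eq (x : D) : xᶜᶜ = x ⊓ x := by
  rw [← ax4a x, ax8a]

lemma compl_mem_meetPart (x : D) : xᶜ ⊓ xᶜ = xᶜ := by
  rw [← compl_compl_eq, compl_compl_eq x, ax4a]

lemma inf_top_eq (x : D) : x ⊓ ⊤ = x ⊓ x := by
  rw [← ax9b x, ax5a]

lemma inf_bot_eq (x : D) : x ⊓ ⊥ = ⊥ := by
  rw [← ax9a x, ax3a, ax1a]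

lemma vee_comm (x y : D) : vee x y = vee y x := by
  rw [vee, vee, ax2a]

lemma vee_mem_meetPart (x y : D) : vee x y ⊓ vee x y = vee x y :=
  compl_mem_meetPart _

lemma vee_inf_self (x y : D) : vee (x ⊓ x) (y ⊓ y) = vee x y := by
  rw [vee, ax4a, ax4a, vee]

/-- The dual double Boolean algebra. -/
def Dual (D : Type u) : Type u := D

instance : DBAOps (Dual D) where
  min x y := (max (α := D) x y : D)
  max x y := (min (α := D) x y : D)
  compl x := (hnot (α := D) x : D)
  hnot x := (compl (α := D) x : D)
  top := (⊥ : D)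
  bot := (⊤ : D)

/-- The two halves of the axiom list trade places and (12) is self-dual, so results about the meet
part transfer to the join part. -/
instance : DoubleBooleanAlgebra (Dual D) where
  ax1a := ax1b (D := D)
  ax2a := ax2b (D := D)
  ax3a := ax3b (D := D)
  ax4a := ax4b (D := D)
  ax5a := ax5b (D := D)
  ax6a := ax6b (D := D)
  ax7a := ax7b (D := D)
  ax8a := ax8b (D := D)
  ax9a := ax9b (D := D)
  ax10a := ax10b (D := D)
  ax11a := ax11b (D := D)
  ax1b := ax1a (D := D)
  ax2b := ax2a (D := D)
  ax3b := ax3a (D := D)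
  ax4b := ax4a (D := D)
  ax5b := ax5a (D := D)
  ax6b := ax6a (D := D)
  ax7b := ax7a (D := D)
  ax8b := ax8a (D := D)
  ax9b := ax9a (D := D)
  ax10b := ax10a (D := D)
  ax11b := ax11a (D := D)
  ax12 x := (ax12 (D := D) x).symm

lemma sup_mem_joinPart (x y : D) : (x ⊔ y) ⊔ (x ⊔ y) = x ⊔ y :=
  inf_mem_meetPart (D := Dual D) x y

variable (D) in
/-- The Boolean algebra `D_⊓` of the elements with `x ⊓ x = x`. -/
def MeetPart : Type u := {x : D // x ⊓ x = x}

/-- The supremum is `vee`, not ⊔, which may leave the meet part. Absorption `ax7a` makes it an upper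
bound and distributivity `ax6a` makes it the least one. -/
instance : Lattice (MeetPart D) where
  le a b := a.1 ⊓ b.1 = a.1
  le_refl a := a.2
  le_trans a b c hab hbc := by rw [← hab, ← ax3a, hbc]
  le_antisymm a b hab hba := Subtype.ext (by rw [← hab, ax2a, hba])
  inf a b := ⟨a.1 ⊓ b.1, inf_mem_meetPart _ _⟩
  sup a b := ⟨vee a.1 b.1, vee_mem_meetPart _ _⟩
  inf_le_left a b := by
    change (a.1 ⊓ b.1) ⊓ a.1 = a.1 ⊓ b.1
    rw [ax2a, ax3a, a.2]
  inf_le_right a b := by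
    change (a.1 ⊓ b.1) ⊓ b.1 = a.1 ⊓ b.1
    rw [← ax3a, b.2]
  le_inf a b c hab hac := by
    change a.1 ⊓ (b.1 ⊓ c.1) = a.1
    rw [ax3a, hab, hac]
  le_sup_left a b := by
    change a.1 ⊓ vee a.1 b.1 = a.1
    rw [ax7a, a.2]
  le_sup_right a b := by
    change b.1 ⊓ vee a.1 b.1 = b.1
    rw [vee_comm, ax7a, b.2]
  sup_le a b c hac hbc := by
    change vee a.1 b.1 ⊓ c.1 = vee a.1 b.1
    rw [ax2a, ax6a, ax2a c.1, ax2a c.1, hac, hbc]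

instance : DistribLattice (MeetPart D) :=
  DistribLattice.ofInfSupLe fun a b c =>
    le_of_eq (Subtype.ext (ax6a a.1 b.1 c.1))

/-- The greatest element is ⊥ᶜ = ⊤ ⊓ ⊤, since ⊤ itself need not be idempotent for ⊓. -/
instance : BooleanAlgebra (MeetPart D) where
  compl a := ⟨a.1ᶜ, compl_mem_meetPart _⟩
  top := ⟨⊥ᶜ, compl_mem_meetPart _⟩
  bot := ⟨⊥, inf_bot_eq _⟩
  inf_compl_le_bot a := le_of_eq (Subtype.ext (ax9a a.1))
  top_le_sup_compl a := le_of_eq (Subtype.ext (by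
    change (⊥ : D)ᶜ = (a.1ᶜ ⊓ a.1ᶜᶜ)ᶜ
    rw [ax9a]))
  le_top a := by
    change a.1 ⊓ (⊥ : D)ᶜ = a.1
    rw [ax10a, inf_inf_self_right, inf_top_eq, a.2]
  bot_le a := by
    change (⊥ : D) ⊓ a.1 = ⊥
    rw [ax2a, inf_bot_eq]

variable (D) in
/-- The Boolean homomorphisms from the meet part of `D` to `Bool`, seen as maps on `D`. -/
abbrev MeetPoint : Type u :=
  {f : D → Bool // (∀ x y, f (x ⊓ y) = (f x && f y)) ∧ ∀ x, f xᶜ = !f x}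

variable (D) in
/-- The Boolean homomorphisms from the join part of `D` to `Bool`, seen as maps on `D`. -/
abbrev JoinPoint : Type u :=
  {f : D → Bool // (∀ x y, f (x ⊔ y) = (f x || f y)) ∧ ∀ x, f (￢x) = !f x}

lemma MeetPoint.map_inf (f : MeetPoint D) (x y : D) : f.1 (x ⊓ y) = (f.1 x && f.1 y) := f.2.1 x y

lemma MeetPoint.map_compl (f : MeetPoint D) (x : D) : f.1 xᶜ = !f.1 x := f.2.2 x

/-- A point sees x only through x ⊓ x, which is why maps on all of D can stand for homomorphisms on
the meet part. -/
lemma MeetPoint.map_inf_self (f : MeetPoint D) (x : D) : f.1 (x ⊓ x) = f.1 x := by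
  rw [f.map_inf, Bool.and_self]

lemma MeetPoint.map_bot (f : MeetPoint D) : f.1 ⊥ = false := by
  rw [← ax9a (⊥ : D), f.map_inf, f.map_compl, Bool.and_not_self]

lemma MeetPoint.map_top (f : MeetPoint D) : f.1 ⊤ = true := by
  rw [← f.map_inf_self, ← ax10a, f.map_compl, f.map_bot, Bool.not_false]

/-- Points of the join part are points of the meet part of the dual algebra. -/
def JoinPoint.toDual (f : JoinPoint D) : MeetPoint (Dual D) :=
  ⟨fun x => !f.1 x, fun x y => (congrArg not (f.2.1 x y)).trans (Bool.not_or _ _),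
    fun x => congrArg not (f.2.2 x)⟩

/-- Points of the meet part of the dual algebra are points of the join part. -/
def JoinPoint.ofDual (f : MeetPoint (Dual D)) : JoinPoint D :=
  ⟨fun x => !f.1 x, fun x y => (congrArg not (f.2.1 x y)).trans (Bool.not_and _ _),
    fun x => congrArg not (f.2.2 x)⟩

/-- Points of the meet part are points of the join part of the dual algebra. -/
def MeetPoint.toDual (f : MeetPoint D) : JoinPoint (Dual D) :=
  ⟨fun x => !f.1 x, fun x y => (congrArg not (f.2.1 x y)).trans (Bool.not_and _ _),
    fun x => congrArg not (f.2.2 x)⟩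

/-- Points of the join part of the dual algebra are points of the meet part. -/
def MeetPoint.ofDual (f : JoinPoint (Dual D)) : MeetPoint D :=
  ⟨fun x => !f.1 x, fun x y => (congrArg not (f.2.1 x y)).trans (Bool.not_or _ _),
    fun x => congrArg not (f.2.2 x)⟩

lemma JoinPoint.map_sup (f : JoinPoint D) (x y : D) : f.1 (x ⊔ y) = (f.1 x || f.1 y) := f.2.1 x y

lemma JoinPoint.map_hnot (f : JoinPoint D) (x : D) : f.1 (￢x) = !f.1 x := f.2.2 x

lemma JoinPoint.map_sup_self (f : JoinPoint D) (x : D) : f.1 (x ⊔ x) = f.1 x := by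
  rw [f.map_sup, Bool.or_self]

lemma JoinPoint.map_top (f : JoinPoint D) : f.1 ⊤ = true := by
  rw [← ax9b (⊥ : D), f.map_sup, f.map_hnot, Bool.or_not_self]

lemma JoinPoint.map_bot (f : JoinPoint D) : f.1 ⊥ = false := by
  rw [← f.map_sup_self, ← ax10b, f.map_hnot, f.map_top, Bool.not_true]

/-- The prime ideal theorem for the meet part. -/
theorem exists_meetPoint (I : Set D) (hbot : ⊥ ∈ I) (hvee : ∀ a ∈ I, ∀ b ∈ I, vee a b ∈ I)
    (hdown : ∀ a ∈ I, ∀ b, b ⊓ a = b ⊓ b → b ∈ I) {y : D} (hy : y ∉ I) :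
    ∃ f : MeetPoint D, f.1 y = true ∧ ∀ a ∈ I, f.1 a = false := by
  classical
  have hI : Order.IsIdeal {a : MeetPart D | a.1 ∈ I} :=
    ⟨fun a b hba ha => hdown a.1 ha b.1 ((show b.1 ⊓ a.1 = b.1 from hba).trans b.2.symm),
      ⟨⊥, hbot⟩,
      fun a ha b hb => ⟨a ⊔ b, hvee _ ha _ hb, le_sup_left, le_sup_right⟩⟩
  -- The projection onto the meet part preserves ⊓ and complement, so the indicator of the
  -- complement of a prime ideal pulls back along it to a point.
  let p : D → MeetPart D := fun x => ⟨x ⊓ x, inf_mem_meetPart x x⟩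
  have hp_inf : ∀ x z, p (x ⊓ z) = p x ⊓ p z := fun x z => Subtype.ext (by
    change (x ⊓ z) ⊓ (x ⊓ z) = (x ⊓ x) ⊓ (z ⊓ z)
    rw [inf_mem_meetPart, inf_inf_self_right, ax1a])
  have hp_compl : ∀ x, p xᶜ = (p x)ᶜ := fun x => Subtype.ext (by
    change xᶜ ⊓ xᶜ = (x ⊓ x)ᶜ
    rw [compl_mem_meetPart, ax4a])
  obtain ⟨J, hJ, hIJ, hFJ⟩ := DistribLattice.prime_ideal_of_disjoint_filter_ideal
    (F := Order.PFilter.principal (p y)) (I := hI.toIdeal) (by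
      rw [Set.disjoint_left]
      intro a (ha : (y ⊓ y) ⊓ a.1 = y ⊓ y) (haI : a.1 ∈ I)
      exact hy (hdown a.1 haI y (by rw [← ax1a, ha])))
  refine ⟨⟨fun x => decide (p x ∉ J), fun x z => ?_, fun x => ?_⟩, ?_, fun a ha => ?_⟩
  · beta_reduce
    rw [hp_inf, ← Bool.decide_and, decide_eq_decide, ← not_or, not_iff_not]
    exact ⟨fun h => hJ.mem_or_mem h, fun h => h.elim (J.lower inf_le_left) (J.lower inf_le_right)⟩
  · beta_reduce
    rw [hp_compl, ← decide_not, decide_eq_decide, not_iff_not]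
    refine ⟨fun h h' => ?_, hJ.compl_mem_of_notMem⟩
    have := Order.Ideal.sup_mem h' h
    rw [sup_compl_eq_top] at this
    exact hJ.toIsProper.ne_top (Order.Ideal.top_of_top_mem this)
  · exact decide_eq_true (Set.disjoint_left.1 hFJ (Order.PFilter.mem_principal.2 le_rfl))
  · refine decide_eq_false (not_not.2 (hIJ ?_))
    change a ⊓ a ∈ I
    exact hdown a ha _ (by rw [ax1a, inf_mem_meetPart])

/-- The prime ideal theorem for the join part. -/
theorem exists_joinPoint (J : Set D) (htop : ⊤ ∈ J) (hwedge : ∀ a ∈ J, ∀ b ∈ J, wedge a b ∈ J)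
    (hup : ∀ a ∈ J, ∀ b, b ⊔ a = b ⊔ b → b ∈ J) {y : D} (hy : y ∉ J) :
    ∃ f : JoinPoint D, f.1 y = false ∧ ∀ a ∈ J, f.1 a = true := by
  obtain ⟨f, h1, h2⟩ := exists_meetPoint (D := Dual D) J htop hwedge hup hy
  exact ⟨JoinPoint.ofDual f, congrArg not h1, fun a ha => congrArg not (h2 a ha)⟩

/-- The elements a with a ⊓ y = a ⊓ a form an ideal containing y. If x lay outside it, some point
would be true at x and false at y. -/
theorem inf_eq_of_forall_meetPoint {x y : D} (h : ∀ f : MeetPoint D, f.1 x = true → f.1 y = true) :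
    x ⊓ y = x ⊓ x := by
  by_contra hxy
  obtain ⟨f, hx, hy⟩ := exists_meetPoint {a : D | a ⊓ y = a ⊓ a} (y := x)
    ((ax2a _ _).trans ((inf_bot_eq y).trans (inf_bot_eq _).symm))
    (fun a (ha : a ⊓ y = a ⊓ a) b (hb : b ⊓ y = b ⊓ b) => by
      change vee a b ⊓ y = vee a b ⊓ vee a b
      rw [ax2a, ax6a, ax2a y, ax2a y, ha, hb, vee_inf_self, vee_mem_meetPart])
    (fun a (ha : a ⊓ y = a ⊓ a) b hb => by
      change b ⊓ y = b ⊓ b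
      rw [← ax1a, ← hb, ← ax3a, ha, inf_inf_self_right])
    hxy
  exact Bool.noConfusion ((h f hx).symm.trans (hy y rfl))

theorem inf_self_eq_of_forall_meetPoint {x y : D} (h : ∀ f : MeetPoint D, f.1 x = f.1 y) :
    x ⊓ x = y ⊓ y := by
  rw [← inf_eq_of_forall_meetPoint fun f hf => (h f).symm.trans hf, ax2a,
    inf_eq_of_forall_meetPoint fun f hf => (h f).trans hf]

theorem sup_self_eq_of_forall_joinPoint {x y : D} (h : ∀ f : JoinPoint D, f.1 x = f.1 y) :
    x ⊔ x = y ⊔ y :=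
  inf_self_eq_of_forall_meetPoint (D := Dual D) fun f => Bool.not_inj (h (JoinPoint.ofDual f))

/-- Apply g to the absorption law z ⊓ (z ⊔ w) = z ⊓ z. This mixed axiom is what links meet points to
the operation ⊔. -/
lemma MeetPoint.map_sup_self_of_eq_true (g : MeetPoint D) {z w : D} (h : g.1 z = true) :
    g.1 (z ⊔ w) = true := by
  have := congrArg g.1 (ax5a z w)
  rw [g.map_inf, g.map_inf_self, h, Bool.true_and] at this
  exact this

/-- The elements x with g (x ⊔ x) true form a filter for the join part that contains everything true
at g. Since y is outside it, the prime ideal theorem extends the filter to a join point false at y.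
-/
theorem MeetPoint.exists_joinPoint (g : MeetPoint D) {y : D} (hy : g.1 (y ⊔ y) = false) :
    ∃ m : JoinPoint D, (∀ z, g.1 z = true → m.1 z = true) ∧ m.1 y = false := by
  obtain ⟨m, hm, h⟩ := DBA.exists_joinPoint {x : D | g.1 (x ⊔ x) = true} (y := y)
    (g.map_sup_self_of_eq_true g.map_top)
    (fun a (ha : g.1 (a ⊔ a) = true) b (hb : g.1 (b ⊔ b) = true) => by
      refine g.map_sup_self_of_eq_true ?_
      -- Closure under `wedge`: the element (a ⊔ a) ⊓ (b ⊔ b) is true at g, and joining it with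
      -- `wedge a b` gives back `wedge a b`.
      have hu : g.1 ((a ⊔ a) ⊓ (b ⊔ b)) = true := by rw [g.map_inf, ha, hb, Bool.and_self]
      have h1 : ((a ⊔ a) ⊓ (b ⊔ b)) ⊔ a = a ⊔ a := by
        rw [ax2b, ← ax1b, ax5b, sup_mem_joinPart]
      have h2 : ((a ⊔ a) ⊓ (b ⊔ b)) ⊔ b = b ⊔ b := by
        rw [ax2b, ← ax1b, ax2a, ax5b, sup_mem_joinPart]
      have h3 : ((a ⊔ a) ⊓ (b ⊔ b)) ⊔ wedge a b = wedge a b := by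
        rw [ax6b, h1, h2, wedge, ax4b, ax4b, wedge]
      rw [← h3]
      exact g.map_sup_self_of_eq_true hu)
    (fun a (ha : g.1 (a ⊔ a) = true) b hb => by
      change g.1 (b ⊔ b) = true
      rw [← hb, ax2b, ← ax1b]
      exact g.map_sup_self_of_eq_true ha)
    (by simp [hy])
  exact ⟨m, fun z hz => h z (g.map_sup_self_of_eq_true hz), hm⟩

theorem JoinPoint.exists_meetPoint (m : JoinPoint D) {x : D} (hx : m.1 (x ⊓ x) = true) :
    ∃ g : MeetPoint D, (∀ z, g.1 z = true → m.1 z = true) ∧ g.1 x = true := by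
  obtain ⟨g, h, hg⟩ := MeetPoint.exists_joinPoint m.toDual (y := x) (congrArg not hx)
  refine ⟨MeetPoint.ofDual g, fun z hz => ?_, congrArg not hg⟩
  by_contra hm
  have h1 : g.1 z = true := h z (by simpa [JoinPoint.toDual] using hm)
  have h2 : (!g.1 z) = true := hz
  simp [h1] at h2

end Algebra

/-! ### Stone spaces and continuous relations -/

section Topology

open Set Topology TopologicalSpace

lemma IsStoneSpace.totallySeparatedSpace {X : Type u} [TopologicalSpace X] (h : IsStoneSpace X) :
    TotallySeparatedSpace X :=
  totallySeparatedSpace_iff_exists_isClopen.2 fun x y hxy => h.2 x y hxy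

/-- In a compact space, a separating algebra of clopen sets contains all clopen sets. -/
theorem mem_of_isClopen_of_separating {X : Type u} [TopologicalSpace X] [CompactSpace X]
    (S : Set (Set X)) (hS : ∀ s ∈ S, IsClopen s) (hempty : ∅ ∈ S)
    (hunion : ∀ s ∈ S, ∀ t ∈ S, s ∪ t ∈ S) (hcompl : ∀ s ∈ S, sᶜ ∈ S)
    (hsep : ∀ x y : X, x ≠ y → ∃ s ∈ S, x ∈ s ∧ y ∉ s) {U : Set X} (hU : IsClopen U) : U ∈ S := by
  -- Compactness is used twice: on U, to separate it from a single outside point by a member of S,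
  -- and then on the complement of U, to cover it by members of S disjoint from U.
  have key : ∀ y ∉ U, ∃ s ∈ S, U ⊆ s ∧ y ∉ s := fun y hy => by
    refine hU.isClosed.isCompact.induction_on (p := fun T => ∃ s ∈ S, T ⊆ s ∧ y ∉ s)
      ⟨∅, hempty, subset_rfl, notMem_empty y⟩
      (fun T T' hT ⟨s, h1, h2, h3⟩ => ⟨s, h1, hT.trans h2, h3⟩)
      (fun T T' ⟨s, h1, h2, h3⟩ ⟨s', h1', h2', h3'⟩ =>
        ⟨s ∪ s', hunion s h1 s' h1', union_subset_union h2 h2', not_or.2 ⟨h3, h3'⟩⟩)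
      (fun x hx => ?_)
    obtain ⟨s, hs, hxs, hys⟩ := hsep x y (fun h => hy (h ▸ hx))
    exact ⟨s, mem_nhdsWithin_of_mem_nhds ((hS s hs).isOpen.mem_nhds hxs), s, hs, subset_rfl, hys⟩
  obtain ⟨s, hs, h1, h2⟩ : ∃ s ∈ S, Uᶜ ⊆ s ∧ Disjoint s U := by
    refine hU.compl.isClosed.isCompact.induction_on
      (p := fun T => ∃ s ∈ S, T ⊆ s ∧ Disjoint s U)
      ⟨∅, hempty, subset_rfl, empty_disjoint U⟩
      (fun T T' hT ⟨s, h1, h2, h3⟩ => ⟨s, h1, hT.trans h2, h3⟩)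
      (fun T T' ⟨s, h1, h2, h3⟩ ⟨s', h1', h2', h3'⟩ =>
        ⟨s ∪ s', hunion s h1 s' h1', union_subset_union h2 h2', h3.union_left h3'⟩)
      (fun y hy => ?_)
    obtain ⟨s, hs, hUs, hys⟩ := key y hy
    exact ⟨sᶜ, mem_nhdsWithin_of_mem_nhds ((hS s hs).compl.isOpen.mem_nhds hys), sᶜ,
      hcompl s hs, subset_rfl, disjoint_compl_left_iff_subset.2 hUs⟩
  have : s = Uᶜ := (subset_compl_iff_disjoint_right.2 h2).antisymm h1
  rw [← compl_compl U, ← this]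
  exact hcompl s hs

theorem IsCompact.exists_isClopen_between {X : Type u} [TopologicalSpace X] [CompactSpace X]
    [TotallySeparatedSpace X] {C O : Set X} (hC : IsCompact C) (hO : IsOpen O) (h : C ⊆ O) :
    ∃ V : Set X, IsClopen V ∧ C ⊆ V ∧ V ⊆ O := by
  refine hC.induction_on (p := fun T => ∃ V : Set X, IsClopen V ∧ T ⊆ V ∧ V ⊆ O)
    ⟨∅, isClopen_empty, subset_rfl, empty_subset O⟩
    (fun T T' hT ⟨V, h1, h2, h3⟩ => ⟨V, h1, hT.trans h2, h3⟩)
    (fun T T' ⟨V, h1, h2, h3⟩ ⟨V', h1', h2', h3'⟩ =>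
      ⟨V ∪ V', h1.union h1', union_subset_union h2 h2', union_subset h3 h3'⟩)
    (fun x hx => ?_)
  obtain ⟨V, hV, hxV, hVO⟩ := compact_exists_isClopen_in_isOpen hO (h hx)
  exact ⟨V, mem_nhdsWithin_of_mem_nhds (hV.isOpen.mem_nhds hxV), V, hV, subset_rfl, hVO⟩

variable {X : Type u} {Y : Type v} [TopologicalSpace X] [TopologicalSpace Y] {R : X → Y → Prop}

/-- Inverse images of clopen sets under continuous relations are clopen. -/
theorem RelContinuous.isClopen (hR : RelContinuous R) {B : Set Y} (hB : IsClopen B) :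
    IsClopen {x | ({y | R x y} ∩ B).Nonempty} := by
  constructor
  · rw [← isOpen_compl_iff, isOpen_iff_mem_nhds]
    intro x hx
    -- Missing B means lying inside the open set Bᶜ, so upper hemicontinuity opens the complement.
    -- Lower hemicontinuity opens the set itself.
    have h1 : {y | R x y} ⊆ Bᶜ := fun y hy hB => hx ⟨y, hy, hB⟩
    have h2 := hR.2 x Bᶜ (hB.compl.isOpen.mem_nhdsSet.2 h1)
    filter_upwards [h2] with x' hx' ⟨y, hy, hyB⟩
    exact subset_of_mem_nhdsSet hx' hy hyB
  · rw [isOpen_iff_mem_nhds]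
    intro x hx
    filter_upwards [hR.1 x B ⟨hB.isOpen, hx⟩] with x' hx' using hx'.2

/-- The lower half can be tested on a basis of clopen sets. For the upper half, the compact set R(x)
lies in a clopen V inside the given open set, and R(x') ⊆ V is the clopen condition that R(x')
misses Vᶜ. -/
theorem relContinuous_of_isClopen [CompactSpace Y] [TotallySeparatedSpace Y]
    (hcl : ∀ x, IsClosed {y | R x y})
    (h : ∀ B : Set Y, IsClopen B → IsClopen {x | ({y | R x y} ∩ B).Nonempty}) :
    RelContinuous R := by
  constructor
  · rintro x O ⟨hO, y, hy, hyO⟩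
    obtain ⟨V, hV, hyV, hVO⟩ := compact_exists_isClopen_in_isOpen hO hyO
    filter_upwards [(h V hV).isOpen.mem_nhds ⟨y, hy, hyV⟩] with x' hx'
    exact ⟨hO, hx'.mono (inter_subset_inter_right _ hVO)⟩
  · intro x t ht
    obtain ⟨O, hO, hxO, hOt⟩ := mem_nhdsSet_iff_exists.1 ht
    obtain ⟨V, hV, hxV, hVO⟩ := IsCompact.exists_isClopen_between (hcl x).isCompact hO hxO
    have hx : x ∈ {x | ({y | R x y} ∩ Vᶜ).Nonempty}ᶜ := fun ⟨y, hy, hyV⟩ => hyV (hxV hy)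
    filter_upwards [(h Vᶜ hV.compl).compl.isOpen.mem_nhds hx] with x' hx'
    refine mem_nhdsSet_iff_exists.2 ⟨O, hO, fun y hy => hVO ?_, hOt⟩
    by_contra hyV
    exact hx' ⟨y, hy, hyV⟩

/-- Stone duality: an isomorphism between the algebras of clopen sets of two Stone spaces is
induced by a homeomorphism. -/
theorem exists_homeomorph_of_clopens {X Y : Type u} [TopologicalSpace X] [TopologicalSpace Y]
    [CompactSpace X] [TotallySeparatedSpace X] [CompactSpace Y] [TotallySeparatedSpace Y]
    (φ : Clopens Y ≃o Clopens X) :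
    ∃ α : X ≃ₜ Y, ∀ U : Clopens Y, α ⁻¹' (U : Set Y) = φ U := by
  -- The clopen sets U with x ∈ φ U are nonempty and closed under intersection, so by compactness
  -- they share a point y, the image of x.
  have h0 : ∀ x : X, ∃ y : Y, ∀ U : Clopens Y, x ∈ φ U → y ∈ U := fun x => by
    have : Nonempty {U : Clopens Y // x ∈ φ U} := ⟨⟨⊤, by rw [map_top]; exact mem_univ x⟩⟩
    have := IsCompact.nonempty_iInter_of_directed_nonempty_isCompact_isClosed
      (fun U : {U : Clopens Y // x ∈ φ U} => (U.1 : Set Y))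
      (fun U V => ⟨⟨U.1 ⊓ V.1, by rw [map_inf]; exact ⟨U.2, V.2⟩⟩, inter_subset_left,
        inter_subset_right⟩)
      (fun U => by
        rw [Set.nonempty_iff_ne_empty]
        intro h
        have h1 : U.1 = ⊥ := Clopens.ext h
        have h2 := U.2
        rw [h1, map_bot] at h2
        exact h2)
      (fun U => U.1.isClosed.isCompact) (fun U => U.1.isClosed)
    obtain ⟨y, hy⟩ := this
    exact ⟨y, fun U hU => mem_iInter.1 hy ⟨U, hU⟩⟩
  choose f hf' using h0
  -- The converse inclusion comes from applying the defining property of f to the complement of U.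
  have hf : ∀ U : Clopens Y, f ⁻¹' (U : Set Y) = φ U := fun U => by
    ext x
    refine ⟨fun h => ?_, hf' x U⟩
    by_contra hx
    have : x ∈ φ Uᶜ := by rw [map_compl']; exact hx
    exact hf' x _ this h
  have hcont : Continuous f := by
    rw [isTopologicalBasis_isClopen.continuous_iff]
    intro U hU
    exact (hf ⟨U, hU⟩).symm ▸ (φ ⟨U, hU⟩).isOpen
  have hinj : Function.Injective f := fun x y hxy => by
    by_contra hne
    obtain ⟨U, hU, hx, hy⟩ := exists_isClopen_of_totally_separated hne
    have h1 := hf (φ.symm ⟨U, hU⟩)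
    rw [OrderIso.apply_symm_apply] at h1
    have hx' : x ∈ f ⁻¹' (φ.symm ⟨U, hU⟩ : Set Y) := h1 ▸ hx
    have hy' : y ∈ f ⁻¹' (φ.symm ⟨U, hU⟩ : Set Y) := by rw [mem_preimage, ← hxy]; exact hx'
    rw [h1] at hy'
    exact hy hy'
  have hsurj : Function.Surjective f := fun y => by
    by_contra hy
    -- The range is compact, hence closed. A clopen neighbourhood V of y that misses it has φ V = ⊥,
    -- which forces V = ⊥.
    obtain ⟨V, hV, hyV, hVO⟩ := compact_exists_isClopen_in_isOpen
      (isCompact_range hcont).isClosed.isOpen_compl (show y ∈ (range f)ᶜ from hy)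
    have h1 : φ ⟨V, hV⟩ = ⊥ := Clopens.ext (by
      rw [← hf]
      exact eq_empty_of_forall_notMem fun x hx => hVO hx ⟨x, rfl⟩)
    rw [map_eq_bot_iff] at h1
    have h2 : y ∈ (⟨V, hV⟩ : Clopens Y) := hyV
    rw [h1] at h2
    exact h2
  exact ⟨Continuous.homeoOfEquivCompactToT2 (f := Equiv.ofBijective f ⟨hinj, hsurj⟩) hcont, hf⟩

end Topology

/-! ### The algebra of clopen protoconcepts of a Stone context -/

namespace CTS

variable (K : CTS.{u})

/-- The operators ◇ and ■ form a Galois connection, the source of the closure identities used for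
protoconcepts. -/
lemma diamond_subset_iff {A : Set K.G} {B : Set K.M} : K.diamond B ⊆ A ↔ B ⊆ K.blackBox A :=
  ⟨fun h m hm _ hg => h ⟨m, hg, hm⟩, fun h _ ⟨_, hgm, hm⟩ => h hm hgm⟩

/-- This expresses ■ through the inverse image under the converse relation, to which continuity of
that relation applies. -/
lemma blackBox_eq (A : Set K.G) : K.blackBox A = {m | ({g | K.R g m} ∩ Aᶜ).Nonempty}ᶜ := by
  ext m
  exact ⟨fun h ⟨g, hg, hgA⟩ => hgA (h hg), fun h g hg => by_contra fun hgA => h ⟨g, hg, hgA⟩⟩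

lemma diamond_mono {B B' : Set K.M} (h : B ⊆ B') : K.diamond B ⊆ K.diamond B' :=
  fun _ ⟨m, hgm, hm⟩ => ⟨m, hgm, h hm⟩

lemma blackBox_mono {A A' : Set K.G} (h : A ⊆ A') : K.blackBox A ⊆ K.blackBox A' :=
  fun _ hm => Set.Subset.trans hm h

lemma diamond_blackBox_subset (A : Set K.G) : K.diamond (K.blackBox A) ⊆ A :=
  K.diamond_subset_iff.2 subset_rfl

lemma subset_blackBox_diamond (B : Set K.M) : B ⊆ K.blackBox (K.diamond B) :=
  K.diamond_subset_iff.1 subset_rfl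

lemma blackBox_diamond_blackBox (A : Set K.G) :
    K.blackBox (K.diamond (K.blackBox A)) = K.blackBox A :=
  (K.blackBox_mono (K.diamond_blackBox_subset A)).antisymm (K.subset_blackBox_diamond _)

lemma diamond_blackBox_diamond (B : Set K.M) :
    K.diamond (K.blackBox (K.diamond B)) = K.diamond B :=
  (K.diamond_blackBox_subset _).antisymm (K.diamond_mono (K.subset_blackBox_diamond B))

lemma diamond_empty : K.diamond ∅ = ∅ := by simp [diamond]

lemma blackBox_univ : K.blackBox Set.univ = Set.univ := by simp [blackBox]

end CTS

lemma IsCTSCR.isClopen_diamond {K : CTS.{u}} (hK : IsCTSCR K) {B : Set K.M} (hB : IsClopen B) :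
    IsClopen (K.diamond B) :=
  hK.continuous.isClopen hB

lemma IsCTSCR.isClopen_blackBox {K : CTS.{u}} (hK : IsCTSCR K) {A : Set K.G} (hA : IsClopen A) :
    IsClopen (K.blackBox A) := by
  rw [K.blackBox_eq]
  exact (hK.continuous_conv.isClopen hA.compl).compl

/-- The clopen object oriented protoconcepts of a Stone context. -/
@[ext]
structure Protoconcept (K : Scxt.{u}) : Type u where
  extent : Set K.cts.G
  intent : Set K.cts.M
  isClopen_extent : IsClopen extent
  isClopen_intent : IsClopen intent
  proto : K.cts.diamond (K.cts.blackBox extent) = K.cts.diamond intent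

namespace Protoconcept

variable {K : Scxt.{u}}

/-- The protoconcept determined by a clopen set of objects. -/
def ofExtent (A : Set K.cts.G) (hA : IsClopen A) : Protoconcept K :=
  ⟨A, K.cts.blackBox A, hA, K.isStone.toIsCTSCR.isClopen_blackBox hA, rfl⟩

/-- The protoconcept determined by a clopen set of properties. -/
def ofIntent (B : Set K.cts.M) (hB : IsClopen B) : Protoconcept K :=
  ⟨K.cts.diamond B, B, K.isStone.toIsCTSCR.isClopen_diamond hB, hB,
    K.cts.diamond_blackBox_diamond B⟩

lemma ofExtent_congr {A A' : Set K.cts.G} {hA : IsClopen A} {hA' : IsClopen A'} (h : A = A') :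
    ofExtent A hA = ofExtent A' hA' := by
  subst h; rfl

lemma ofIntent_congr {B B' : Set K.cts.M} {hB : IsClopen B} {hB' : IsClopen B'} (h : B = B') :
    ofIntent B hB = ofIntent B' hB' := by
  subst h; rfl

lemma blackBox_extent (x : Protoconcept K) :
    K.cts.blackBox x.extent = K.cts.blackBox (K.cts.diamond x.intent) := by
  rw [← x.proto, K.cts.blackBox_diamond_blackBox]

lemma diamond_intent_subset (x : Protoconcept K) : K.cts.diamond x.intent ⊆ x.extent :=
  x.proto ▸ K.cts.diamond_blackBox_subset _

lemma intent_subset (x : Protoconcept K) : x.intent ⊆ K.cts.blackBox x.extent :=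
  K.cts.diamond_subset_iff.1 x.diamond_intent_subset

/-- The order is reversed inclusion: ⊓ unites extents, ⊔ intersects intents, and ⊤ is the empty
pair. -/
instance : DBAOps (Protoconcept K) where
  min x y := ofExtent (x.extent ∪ y.extent) (x.isClopen_extent.union y.isClopen_extent)
  max x y := ofIntent (x.intent ∩ y.intent) (x.isClopen_intent.inter y.isClopen_intent)
  compl x := ofExtent x.extentᶜ x.isClopen_extent.compl
  hnot x := ofIntent x.intentᶜ x.isClopen_intent.compl
  top := ⟨∅, ∅, isClopen_empty, isClopen_empty, by
    rw [K.cts.diamond_empty]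
    exact Set.subset_empty_iff.1 (K.cts.diamond_blackBox_subset ∅)⟩
  bot := ⟨Set.univ, Set.univ, isClopen_univ, isClopen_univ, by rw [K.cts.blackBox_univ]⟩

@[simp] lemma extent_inf (x y : Protoconcept K) : (x ⊓ y).extent = x.extent ∪ y.extent := rfl
@[simp] lemma intent_inf (x y : Protoconcept K) :
    (x ⊓ y).intent = K.cts.blackBox (x.extent ∪ y.extent) := rfl
@[simp] lemma intent_sup (x y : Protoconcept K) : (x ⊔ y).intent = x.intent ∩ y.intent := rfl
@[simp] lemma extent_sup (x y : Protoconcept K) :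
    (x ⊔ y).extent = K.cts.diamond (x.intent ∩ y.intent) := rfl
@[simp] lemma extent_compl (x : Protoconcept K) : xᶜ.extent = x.extentᶜ := rfl
@[simp] lemma intent_compl (x : Protoconcept K) :
    xᶜ.intent = K.cts.blackBox x.extentᶜ := rfl
@[simp] lemma extent_hnot (x : Protoconcept K) : (￢x).extent = K.cts.diamond x.intentᶜ := rfl
@[simp] lemma intent_hnot (x : Protoconcept K) : (￢x).intent = x.intentᶜ := rfl
@[simp] lemma extent_top : (⊤ : Protoconcept K).extent = ∅ := rfl
@[simp] lemma intent_top : (⊤ : Protoconcept K).intent = ∅ := rfl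
@[simp] lemma extent_bot : (⊥ : Protoconcept K).extent = Set.univ := rfl
@[simp] lemma intent_bot : (⊥ : Protoconcept K).intent = Set.univ := rfl
@[simp] lemma extent_vee (x y : Protoconcept K) :
    (vee x y).extent = x.extent ∩ y.extent := by simp [vee]
@[simp] lemma intent_wedge (x y : Protoconcept K) :
    (wedge x y).intent = x.intent ∪ y.intent := by simp [wedge, Set.compl_inter]

/-- Most axioms reduce to Boolean identities between extents or between intents. Only the mixed ones
need more: the Galois connection for (5a) and (5b), and the protoconcept equation for (12). -/
instance : DoubleBooleanAlgebra (Protoconcept K) where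
  ax1a x y := ofExtent_congr (by simp)
  ax2a x y := ofExtent_congr (Set.union_comm _ _)
  ax3a x y z := ofExtent_congr (Set.union_assoc _ _ _).symm
  ax4a x := ofExtent_congr (by simp)
  ax5a x y := ofExtent_congr (by
    rw [extent_sup, Set.union_self, Set.union_eq_left]
    exact (K.cts.diamond_mono Set.inter_subset_left).trans x.diamond_intent_subset)
  ax6a x y z := ofExtent_congr (by
    simp only [extent_vee, extent_compl, extent_inf, ← Set.compl_inter, compl_compl,
      Set.union_inter_distrib_left])
  ax7a x y := ofExtent_congr (by simp)
  ax8a x y := ofExtent_congr (compl_compl _)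
  ax9a x := Protoconcept.ext (by simp) (by simp [K.cts.blackBox_univ])
  ax10a := ofExtent_congr (by simp)
  ax11a := Protoconcept.ext (by simp) (by simp [K.cts.blackBox_univ])
  ax1b x y := ofIntent_congr (by simp)
  ax2b x y := ofIntent_congr (Set.inter_comm _ _)
  ax3b x y z := ofIntent_congr (Set.inter_assoc _ _ _).symm
  ax4b x := ofIntent_congr (by simp)
  ax5b x y := ofIntent_congr (by
    rw [intent_inf, Set.inter_self, Set.inter_eq_left]
    exact x.intent_subset.trans (K.cts.blackBox_mono Set.subset_union_left))
  ax6b x y z := ofIntent_congr (by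
    simp only [intent_wedge, intent_hnot, intent_sup, ← Set.compl_union, compl_compl,
      Set.inter_union_distrib_left])
  ax7b x y := ofIntent_congr (by simp)
  ax8b x y := ofIntent_congr (by simp)
  ax9b x := Protoconcept.ext (by simp [K.cts.diamond_empty]) (by simp)
  ax10b := ofIntent_congr (by simp)
  ax11b := Protoconcept.ext (by simp [K.cts.diamond_empty]) (by simp)
  ax12 x := Protoconcept.ext (by simp [x.proto]) (by simp [x.blackBox_extent])

lemma qle_iff {x y : Protoconcept K} : QLE x y ↔ y.extent ⊆ x.extent ∧ y.intent ⊆ x.intent := by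
  refine and_congr ⟨fun h => ?_, fun h => ofExtent_congr ?_⟩
    ⟨fun h => ?_, fun h => ofIntent_congr ?_⟩
  · simpa using congrArg extent h
  · simpa using h
  · simpa using congrArg intent h
  · simpa using h

theorem isFullyContextual (K : Scxt.{u}) : IsFullyContextual (Protoconcept K) := by
  refine ⟨{ refl := fun x => ⟨rfl, rfl⟩, trans := fun x y z hxy hyz => ?_,
            antisymm := fun x y hxy hyx => ?_ }, fun y x hy hx hyx => ?_⟩
  · rw [qle_iff] at *
    exact ⟨hyz.1.trans hxy.1, hyz.2.trans hxy.2⟩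
  · rw [qle_iff] at *
    exact Protoconcept.ext (hyx.1.antisymm hxy.1) (hyx.2.antisymm hxy.2)
  · have h1 : K.cts.blackBox y.extent = y.intent := by simpa using congrArg intent hy
    have h2 : K.cts.diamond x.intent = x.extent := by simpa using congrArg extent hx
    have h3 : K.cts.diamond y.intent = x.extent := by simpa using congrArg extent hyx
    -- Glue the extent of y to the intent of x. The hypothesis y ⊔ y = x ⊓ x supplies the
    -- protoconcept equation, both sides being the extent of x.
    refine ⟨⟨y.extent, x.intent, y.isClopen_extent, x.isClopen_intent, by rw [h1, h2, h3]⟩,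
      ⟨?_, ?_⟩, ?_⟩
    · exact Protoconcept.ext (by simp) (by simp [h1])
    · exact Protoconcept.ext (by simp [h2]) (by simp)
    · rintro z ⟨rfl, rfl⟩
      exact Protoconcept.ext (by simp) (by simp)

end Protoconcept

/-- The fully contextual double Boolean algebra of the clopen protoconcepts. -/
def Scxt.algebra (K : Scxt.{u}) : FCDBA.{u} := ⟨Protoconcept K, Protoconcept.isFullyContextual K⟩

/-! ### Functoriality -/

section Functor

variable {K L : Scxt.{u}}

lemma CTSHomeo.preimage_diamond (f : CTSHomeo K.cts L.cts) (B : Set L.cts.M) :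
    f.α ⁻¹' L.cts.diamond B = K.cts.diamond (f.β ⁻¹' B) := by
  ext g
  constructor
  · rintro ⟨m, hm, hB⟩
    obtain ⟨m, rfl⟩ := f.β.surjective m
    exact ⟨m, (f.rel_iff g m).2 hm, hB⟩
  · rintro ⟨m, hm, hB⟩
    exact ⟨f.β m, (f.rel_iff g m).1 hm, hB⟩

lemma CTSHomeo.preimage_blackBox (f : CTSHomeo K.cts L.cts) (A : Set L.cts.G) :
    f.β ⁻¹' L.cts.blackBox A = K.cts.blackBox (f.α ⁻¹' A) := by
  ext m
  constructor
  · exact fun h g hg => h ((f.rel_iff g m).1 hg)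
  · intro h g hg
    obtain ⟨g, rfl⟩ := f.α.surjective g
    exact h ((f.rel_iff g m).2 hg)

/-- The inverse image of a protoconcept under a homeomorphism of contexts. -/
def Protoconcept.comap (f : CTSHomeo K.cts L.cts) (x : Protoconcept L) : Protoconcept K where
  extent := f.α ⁻¹' x.extent
  intent := f.β ⁻¹' x.intent
  isClopen_extent := x.isClopen_extent.preimage f.α.continuous
  isClopen_intent := x.isClopen_intent.preimage f.β.continuous
  proto := by
    rw [← f.preimage_blackBox, ← f.preimage_diamond, ← f.preimage_diamond, x.proto]

/-- The inverse of a homeomorphism of contexts. -/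
def CTSHomeo.symm {K L : CTS.{u}} (f : CTSHomeo K L) : CTSHomeo L K where
  α := f.α.symm
  β := f.β.symm
  rel_iff g m := by rw [f.rel_iff]; simp

/-- The isomorphism of algebras of protoconcepts induced by a homeomorphism of contexts. -/
def CTSHomeo.algebraIso (f : CTSHomeo K.cts L.cts) :
    DBAIso (Protoconcept L) (Protoconcept K) where
  toFun := Protoconcept.comap f
  isHom :=
    { map_inf := fun a b => Protoconcept.ext rfl (f.preimage_blackBox _)
      map_sup := fun a b => Protoconcept.ext (f.preimage_diamond _) rfl
      map_compl := fun a => Protoconcept.ext rfl (f.preimage_blackBox _)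
      map_hnot := fun a => Protoconcept.ext (f.preimage_diamond _) rfl
      map_top := Protoconcept.ext rfl rfl
      map_bot := Protoconcept.ext rfl rfl }
  bijective := Function.bijective_iff_has_inverse.2 ⟨Protoconcept.comap f.symm,
    fun x => Protoconcept.ext (by simp [Protoconcept.comap, symm, ← Set.preimage_comp])
      (by simp [Protoconcept.comap, symm, ← Set.preimage_comp]),
    fun x => Protoconcept.ext (by simp [Protoconcept.comap, symm, ← Set.preimage_comp])
      (by simp [Protoconcept.comap, symm, ← Set.preimage_comp])⟩

/-- The functor sending a Stone context to its algebra of clopen protoconcepts. -/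
def algebraFunctor : Scxt.{u} ⥤ FCDBA.{u}ᵒᵖ where
  obj K := Opposite.op K.algebra
  map {K L} f := Quiver.Hom.op (show L.algebra ⟶ K.algebra from CTSHomeo.algebraIso f)

lemma homeomorph_ext_of_clopens {X Y : Type u} [TopologicalSpace X] [TopologicalSpace Y]
    (hY : IsStoneSpace Y) {f g : X ≃ₜ Y} (h : ∀ U : Set Y, IsClopen U → f ⁻¹' U = g ⁻¹' U) :
    f = g := by
  ext x
  by_contra hne
  obtain ⟨U, hU, hx, hy⟩ := hY.2 _ _ hne
  have : x ∈ f ⁻¹' U := hx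
  rw [h U hU] at this
  exact hy this

lemma algebraIso_injective {f f' : CTSHomeo K.cts L.cts} (h : f.algebraIso = f'.algebraIso) :
    f = f' := by
  have h' : ∀ x : Protoconcept L, Protoconcept.comap f x = Protoconcept.comap f' x :=
    fun x => congrFun (congrArg DBAIso.toFun h) x
  refine CTSHomeo.ext (homeomorph_ext_of_clopens L.isStone.stoneG fun U hU => ?_)
    (homeomorph_ext_of_clopens L.isStone.stoneM fun U hU => ?_)
  · exact congrArg Protoconcept.extent (h' (Protoconcept.ofExtent U hU))
  · exact congrArg Protoconcept.intent (h' (Protoconcept.ofIntent U hU))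

/-- Forward, B^◇ ⊆ A for every protoconcept. Backward, clopen semiconcepts are protoconcepts, so the
separation axiom of a Stone context applies. -/
lemma rel_iff_forall_protoconcept (g : K.cts.G) (m : K.cts.M) :
    K.cts.R g m ↔ ∀ x : Protoconcept K, m ∈ x.intent → g ∈ x.extent := by
  refine ⟨fun h x hx => x.diamond_intent_subset ⟨m, h, hx⟩, fun h =>
    K.isStone.rel_of_semiconcepts g m ?_⟩
  rintro A B ⟨rfl | rfl, hA, hB⟩ hm
  · exact h (.ofExtent A hA) hm
  · exact h (.ofIntent B hB) hm

/-! ### Fullness: recovering a homeomorphism of contexts from an isomorphism of algebras -/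

open TopologicalSpace

/-- The element x ⊓ x depends only on the extent of x, and h x has the same extent as h (x ⊓ x).
Hence h acts on clopen sets of objects. -/
lemma DBAIso.extent_apply_congr (h : DBAIso (Protoconcept L) (Protoconcept K))
    {x y : Protoconcept L} (hxy : x.extent = y.extent) :
    (h.toFun x).extent = (h.toFun y).extent := by
  have h1 : x ⊓ x = y ⊓ y := Protoconcept.ofExtent_congr (by rw [hxy])
  simpa [h.isHom.map_inf] using congrArg (fun z => (h.toFun z).extent) h1

lemma DBAIso.intent_apply_congr (h : DBAIso (Protoconcept L) (Protoconcept K))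
    {x y : Protoconcept L} (hxy : x.intent = y.intent) :
    (h.toFun x).intent = (h.toFun y).intent := by
  have h1 : x ⊔ x = y ⊔ y := Protoconcept.ofIntent_congr (by rw [hxy])
  simpa [h.isHom.map_sup] using congrArg (fun z => (h.toFun z).intent) h1

/-- The inverse of a dBa isomorphism. -/
noncomputable def DBAIso.symm {D E : Type u} [DoubleBooleanAlgebra D] [DoubleBooleanAlgebra E]
    (h : DBAIso D E) : DBAIso E D :=
  let e := Equiv.ofBijective h.toFun h.bijective
  have key : ∀ x y, h.toFun x = y → e.symm y = x := fun x y hxy => by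
    rw [← hxy]; exact e.symm_apply_apply x
  have he : ∀ y, h.toFun (e.symm y) = y := e.apply_symm_apply
  { toFun := e.symm
    isHom :=
      { map_inf := fun a b => key _ _ (by rw [h.isHom.map_inf, he, he])
        map_sup := fun a b => key _ _ (by rw [h.isHom.map_sup, he, he])
        map_compl := fun a => key _ _ (by rw [h.isHom.map_compl, he])
        map_hnot := fun a => key _ _ (by rw [h.isHom.map_hnot, he])
        map_top := key _ _ h.isHom.map_top
        map_bot := key _ _ h.isHom.map_bot }
    bijective := e.symm.bijective }

lemma DBAIso.apply_symm_apply {D E : Type u} [DoubleBooleanAlgebra D] [DoubleBooleanAlgebra E]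
    (h : DBAIso D E) (y : E) : h.toFun (h.symm.toFun y) = y :=
  (Equiv.ofBijective h.toFun h.bijective).apply_symm_apply y

lemma DBAIso.symm_apply_apply {D E : Type u} [DoubleBooleanAlgebra D] [DoubleBooleanAlgebra E]
    (h : DBAIso D E) (x : D) : h.symm.toFun (h.toFun x) = x :=
  (Equiv.ofBijective h.toFun h.bijective).symm_apply_apply x

lemma DBAIso.extent_apply_ofExtent (h : DBAIso (Protoconcept L) (Protoconcept K))
    (x : Protoconcept L) :
    (h.toFun (.ofExtent x.extent x.isClopen_extent)).extent = (h.toFun x).extent :=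
  h.extent_apply_congr rfl

lemma DBAIso.extent_apply_mono (h : DBAIso (Protoconcept L) (Protoconcept K))
    {x y : Protoconcept L} (hxy : x.extent ⊆ y.extent) :
    (h.toFun x).extent ⊆ (h.toFun y).extent := by
  have := h.extent_apply_congr (x := x ⊓ y) (y := y) (by simpa using hxy)
  rw [h.isHom.map_inf] at this
  simpa using this

lemma DBAIso.intent_apply_ofIntent (h : DBAIso (Protoconcept L) (Protoconcept K))
    (x : Protoconcept L) :
    (h.toFun (.ofIntent x.intent x.isClopen_intent)).intent = (h.toFun x).intent :=
  h.intent_apply_congr rfl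

lemma DBAIso.intent_apply_mono (h : DBAIso (Protoconcept L) (Protoconcept K))
    {x y : Protoconcept L} (hxy : x.intent ⊆ y.intent) :
    (h.toFun x).intent ⊆ (h.toFun y).intent := by
  have := h.intent_apply_congr (x := x ⊔ y) (y := x) (by simpa using hxy)
  rw [h.isHom.map_sup] at this
  simpa using this

/-- The action of an isomorphism of algebras of protoconcepts on clopen sets of objects. -/
noncomputable def DBAIso.extentIso (h : DBAIso (Protoconcept L) (Protoconcept K)) :
    Clopens L.cts.G ≃o Clopens K.cts.G :=
  have mono : ∀ {K L : Scxt.{u}} (h : DBAIso (Protoconcept L) (Protoconcept K)),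
      Monotone fun U : Clopens L.cts.G =>
        (⟨(h.toFun (.ofExtent U U.isClopen)).extent, (h.toFun _).isClopen_extent⟩ :
          Clopens K.cts.G) := fun h _ _ hUV => h.extent_apply_mono hUV
  Equiv.toOrderIso
    { toFun := fun U => ⟨(h.toFun (.ofExtent U U.isClopen)).extent, (h.toFun _).isClopen_extent⟩
      invFun := fun U => ⟨(h.symm.toFun (.ofExtent U U.isClopen)).extent,
        (h.symm.toFun _).isClopen_extent⟩
      left_inv := fun U => Clopens.ext ((h.symm.extent_apply_ofExtent
        (h.toFun (.ofExtent U U.isClopen))).trans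
        (congrArg Protoconcept.extent (h.symm_apply_apply (.ofExtent U U.isClopen))))
      right_inv := fun U => Clopens.ext ((h.extent_apply_ofExtent
        (h.symm.toFun (.ofExtent U U.isClopen))).trans
        (congrArg Protoconcept.extent (h.apply_symm_apply (.ofExtent U U.isClopen)))) }
    (mono h) (mono h.symm)

/-- The action of an isomorphism of algebras of protoconcepts on clopen sets of properties. -/
noncomputable def DBAIso.intentIso (h : DBAIso (Protoconcept L) (Protoconcept K)) :
    Clopens L.cts.M ≃o Clopens K.cts.M :=
  have mono : ∀ {K L : Scxt.{u}} (h : DBAIso (Protoconcept L) (Protoconcept K)),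
      Monotone fun U : Clopens L.cts.M =>
        (⟨(h.toFun (.ofIntent U U.isClopen)).intent, (h.toFun _).isClopen_intent⟩ :
          Clopens K.cts.M) := fun h _ _ hUV => h.intent_apply_mono hUV
  Equiv.toOrderIso
    { toFun := fun U => ⟨(h.toFun (.ofIntent U U.isClopen)).intent, (h.toFun _).isClopen_intent⟩
      invFun := fun U => ⟨(h.symm.toFun (.ofIntent U U.isClopen)).intent,
        (h.symm.toFun _).isClopen_intent⟩
      left_inv := fun U => Clopens.ext ((h.symm.intent_apply_ofIntent
        (h.toFun (.ofIntent U U.isClopen))).trans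
        (congrArg Protoconcept.intent (h.symm_apply_apply (.ofIntent U U.isClopen))))
      right_inv := fun U => Clopens.ext ((h.intent_apply_ofIntent
        (h.symm.toFun (.ofIntent U U.isClopen))).trans
        (congrArg Protoconcept.intent (h.apply_symm_apply (.ofIntent U U.isClopen)))) }
    (mono h) (mono h.symm)

theorem algebraIso_surjective (h : DBAIso (Protoconcept L) (Protoconcept K)) :
    ∃ f : CTSHomeo K.cts L.cts, f.algebraIso = h := by
  have := K.isStone.stoneG.1
  have := K.isStone.stoneG.totallySeparatedSpace
  have := K.isStone.stoneM.1
  have := K.isStone.stoneM.totallySeparatedSpace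
  have := L.isStone.stoneG.1
  have := L.isStone.stoneG.totallySeparatedSpace
  have := L.isStone.stoneM.1
  have := L.isStone.stoneM.totallySeparatedSpace
  obtain ⟨α, hα⟩ := exists_homeomorph_of_clopens h.extentIso
  obtain ⟨β, hβ⟩ := exists_homeomorph_of_clopens h.intentIso
  have hα' : ∀ x : Protoconcept L, α ⁻¹' x.extent = (h.toFun x).extent := fun x =>
    (hα ⟨x.extent, x.isClopen_extent⟩).trans (h.extent_apply_ofExtent x)
  have hβ' : ∀ x : Protoconcept L, β ⁻¹' x.intent = (h.toFun x).intent := fun x =>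
    (hβ ⟨x.intent, x.isClopen_intent⟩).trans (h.intent_apply_ofIntent x)
  refine ⟨⟨α, β, fun g m => ?_⟩, DBAIso.ext (funext fun x => Protoconcept.ext (hα' x) (hβ' x))⟩
  -- Both relations are tested on protoconcepts. By surjectivity those of K are the images h x,
  -- whose extent and intent are inverse images under α and β.
  rw [rel_iff_forall_protoconcept, rel_iff_forall_protoconcept, h.bijective.surjective.forall]
  simp_rw [← hα', ← hβ']
  rfl

instance : algebraFunctor.{u}.Faithful where
  map_injective h := algebraIso_injective (Quiver.Hom.op_inj h)

instance : algebraFunctor.{u}.Full where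
  map_surjective h := (algebraIso_surjective h.unop).imp fun _ hf =>
    Quiver.Hom.unop_inj hf

end Functor

/-! ### The Stone context of a fully contextual double Boolean algebra -/

section Context

variable {D : Type u} [DoubleBooleanAlgebra D]

open DoubleBooleanAlgebra

lemma isClosed_forall {ι : Sort v} {X : Type u} [TopologicalSpace X] {p : ι → X → Prop}
    (h : ∀ i, IsClosed {x | p i x}) : IsClosed {x | ∀ i, p i x} := by
  rw [Set.ofPred_forall]
  exact isClosed_iInter h

/-- Each defining equation involves finitely many coordinates, so the points form a closed, hence
compact, subspace of the product of copies of `Bool`. -/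
lemma MeetPoint.isClosed :
    IsClosed {f : D → Bool | (∀ x y, f (x ⊓ y) = (f x && f y)) ∧ ∀ x, f xᶜ = !f x} := by
  refine IsClosed.inter ?_ ?_
  · refine isClosed_forall fun x => isClosed_forall fun y => isClosed_eq (by fun_prop) ?_
    exact Continuous.comp (g := fun p : Bool × Bool => p.1 && p.2)
      (f := fun f : D → Bool => (f x, f y)) continuous_of_discreteTopology
      ((continuous_apply x).prodMk (continuous_apply y))
  · refine isClosed_forall fun x => isClosed_eq (by fun_prop) ?_
    exact Continuous.comp (g := not) continuous_of_discreteTopology (continuous_apply x)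

lemma JoinPoint.isClosed :
    IsClosed {f : D → Bool | (∀ x y, f (x ⊔ y) = (f x || f y)) ∧ ∀ x, f (￢x) = !f x} := by
  refine IsClosed.inter ?_ ?_
  · refine isClosed_forall fun x => isClosed_forall fun y => isClosed_eq (by fun_prop) ?_
    exact Continuous.comp (g := fun p : Bool × Bool => p.1 || p.2)
      (f := fun f : D → Bool => (f x, f y)) continuous_of_discreteTopology
      ((continuous_apply x).prodMk (continuous_apply y))
  · refine isClosed_forall fun x => isClosed_eq (by fun_prop) ?_
    exact Continuous.comp (g := not) continuous_of_discreteTopology (continuous_apply x)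

instance : CompactSpace (MeetPoint D) := isCompact_iff_compactSpace.1 MeetPoint.isClosed.isCompact

instance : CompactSpace (JoinPoint D) := isCompact_iff_compactSpace.1 JoinPoint.isClosed.isCompact

/-- The points of the meet part that do not contain `x`. -/
def extentOf (x : D) : Set (MeetPoint D) := {g | g.1 x = false}

/-- The points of the join part that do not contain `x`. -/
def intentOf (x : D) : Set (JoinPoint D) := {m | m.1 x = false}

lemma isClopen_extentOf (x : D) : IsClopen (extentOf x) :=
  (isClopen_discrete {false}).preimage ((continuous_apply x).comp continuous_subtype_val)

lemma isClopen_intentOf (x : D) : IsClopen (intentOf x) :=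
  (isClopen_discrete {false}).preimage ((continuous_apply x).comp continuous_subtype_val)

lemma extentOf_inf (x y : D) : extentOf (x ⊓ y) = extentOf x ∪ extentOf y := by
  ext g; simp only [extentOf, Set.mem_ofPred_eq, g.map_inf, Bool.and_eq_false_iff, Set.mem_union]

lemma extentOf_inf_self (x : D) : extentOf (x ⊓ x) = extentOf x := by
  rw [extentOf_inf, Set.union_self]

lemma extentOf_compl (x : D) : extentOf xᶜ = (extentOf x)ᶜ := by
  ext g; simp [extentOf, g.map_compl]

lemma extentOf_top : extentOf (⊤ : D) = ∅ := by
  ext g; simp [extentOf, g.map_top]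

lemma extentOf_bot : extentOf (⊥ : D) = Set.univ := by
  ext g; simp [extentOf, g.map_bot]

lemma intentOf_sup (x y : D) : intentOf (x ⊔ y) = intentOf x ∩ intentOf y := by
  ext m; simp [intentOf, m.map_sup]

lemma intentOf_sup_self (x : D) : intentOf (x ⊔ x) = intentOf x := by
  rw [intentOf_sup, Set.inter_self]

lemma intentOf_hnot (x : D) : intentOf (￢x) = (intentOf x)ᶜ := by
  ext m; simp [intentOf, m.map_hnot]

lemma intentOf_top : intentOf (⊤ : D) = ∅ := by
  ext m; simp [intentOf, m.map_top]

lemma intentOf_bot : intentOf (⊥ : D) = Set.univ := by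
  ext m; simp [intentOf, m.map_bot]

lemma exists_extentOf_separating {g g' : MeetPoint D} (h : g ≠ g') :
    ∃ x : D, g ∈ extentOf x ∧ g' ∉ extentOf x := by
  obtain ⟨x, hx⟩ := Function.ne_iff.1 (Subtype.coe_injective.ne h)
  cases hg : g.1 x
  · exact ⟨x, hg, fun hg' => hx (hg.trans (Eq.symm hg'))⟩
  -- Membership in `extentOf` means falsity, so when g is true at x the complement separates
  -- instead.
  · refine ⟨xᶜ, by simp [extentOf, g.map_compl, hg], ?_⟩
    rw [extentOf_compl, Set.notMem_compl_iff]
    simpa [hg, extentOf] using hx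

lemma exists_intentOf_separating {m m' : JoinPoint D} (h : m ≠ m') :
    ∃ x : D, m ∈ intentOf x ∧ m' ∉ intentOf x := by
  obtain ⟨x, hx⟩ := Function.ne_iff.1 (Subtype.coe_injective.ne h)
  cases hm : m.1 x
  · exact ⟨x, hm, fun hm' => hx (hm.trans (Eq.symm hm'))⟩
  · refine ⟨￢x, by simp [intentOf, m.map_hnot, hm], ?_⟩
    rw [intentOf_hnot, Set.notMem_compl_iff]
    simpa [hm, intentOf] using hx

lemma isStoneSpace_meetPoint : IsStoneSpace (MeetPoint D) :=
  ⟨inferInstance, fun _ _ h => (exists_extentOf_separating h).imp' extentOf fun x hx =>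
    ⟨isClopen_extentOf x, hx⟩⟩

lemma isStoneSpace_joinPoint : IsStoneSpace (JoinPoint D) :=
  ⟨inferInstance, fun _ _ h => (exists_intentOf_separating h).imp' intentOf fun x hx =>
    ⟨isClopen_intentOf x, hx⟩⟩

lemma exists_extentOf_eq {U : Set (MeetPoint D)} (hU : IsClopen U) : ∃ x : D, extentOf x = U := by
  refine mem_of_isClopen_of_separating (Set.range extentOf) ?_ ⟨⊤, extentOf_top⟩ ?_ ?_ ?_ hU
  · rintro _ ⟨x, rfl⟩
    exact isClopen_extentOf x
  · rintro _ ⟨x, rfl⟩ _ ⟨y, rfl⟩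
    exact ⟨x ⊓ y, extentOf_inf x y⟩
  · rintro _ ⟨x, rfl⟩
    exact ⟨xᶜ, extentOf_compl x⟩
  · intro g g' h
    obtain ⟨x, hx⟩ := exists_extentOf_separating h
    exact ⟨_, ⟨x, rfl⟩, hx⟩

lemma exists_intentOf_eq {U : Set (JoinPoint D)} (hU : IsClopen U) : ∃ x : D, intentOf x = U := by
  refine mem_of_isClopen_of_separating (Set.range intentOf) ?_ ⟨⊤, intentOf_top⟩ ?_ ?_ ?_ hU
  · rintro _ ⟨x, rfl⟩
    exact isClopen_intentOf x
  · rintro _ ⟨x, rfl⟩ _ ⟨y, rfl⟩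
    -- Intents turn ⊔ into intersection, so a union requires De Morgan.
    refine ⟨￢(￢x ⊔ ￢y), ?_⟩
    rw [intentOf_hnot, intentOf_sup, intentOf_hnot, intentOf_hnot, Set.compl_inter, compl_compl,
      compl_compl]
  · rintro _ ⟨x, rfl⟩
    exact ⟨￢x, intentOf_hnot x⟩
  · intro g g' h
    obtain ⟨x, hx⟩ := exists_intentOf_separating h
    exact ⟨_, ⟨x, rfl⟩, hx⟩

lemma inf_self_eq_of_extentOf_eq {x y : D} (h : extentOf x = extentOf y) : x ⊓ x = y ⊓ y :=
  inf_self_eq_of_forall_meetPoint fun f => Bool.eq_iff_iff.2 (by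
    have : f ∈ extentOf x ↔ f ∈ extentOf y := by rw [h]
    simpa [extentOf] using not_congr this)

lemma sup_self_eq_of_intentOf_eq {x y : D} (h : intentOf x = intentOf y) : x ⊔ x = y ⊔ y :=
  sup_self_eq_of_forall_joinPoint fun f => Bool.eq_iff_iff.2 (by
    have : f ∈ intentOf x ↔ f ∈ intentOf y := by rw [h]
    simpa [intentOf] using not_congr this)

variable (D) in
/-- The context of the points of a double Boolean algebra. -/
def pointContext : CTS.{u} where
  G := MeetPoint D
  M := JoinPoint D
  R g m := ∀ z, g.1 z = true → m.1 z = true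

/-- If g R m and m is false at x, then g is false at x ⊔ x. Conversely, `MeetPoint.exists_joinPoint`
produces the required m. -/
lemma diamond_intentOf (x : D) : (pointContext D).diamond (intentOf x) = extentOf (x ⊔ x) := by
  ext g
  constructor
  · rintro ⟨m, hgm, hm⟩
    change g.1 (x ⊔ x) = false
    by_contra hg
    have h1 := hgm _ (Bool.eq_true_of_not_eq_false hg)
    rw [m.map_sup_self, show m.1 x = false from hm] at h1
    exact Bool.noConfusion h1
  · exact fun hg => g.exists_joinPoint hg

lemma blackBox_extentOf (x : D) : (pointContext D).blackBox (extentOf x) = intentOf (x ⊓ x) := by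
  ext m
  constructor
  · intro h
    change m.1 (x ⊓ x) = false
    by_contra hm
    obtain ⟨g, hgm, hg⟩ := m.exists_meetPoint (Bool.eq_true_of_not_eq_false hm)
    exact Bool.noConfusion (hg.symm.trans (h hgm))
  · intro hm g hgm
    change g.1 x = false
    by_contra hg
    have h1 := hgm (x ⊓ x) (by rw [g.map_inf_self]; exact Bool.eq_true_of_not_eq_false hg)
    exact Bool.noConfusion (h1.symm.trans hm)

lemma isClosed_rel_right (g : MeetPoint D) : IsClosed {m | (pointContext D).R g m} := by
  change IsClosed {m : JoinPoint D | ∀ z, g.1 z = true → m.1 z = true}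
  exact isClosed_forall fun z => isClosed_forall fun _ => isClosed_eq
    ((continuous_apply z).comp continuous_subtype_val) continuous_const

lemma isClosed_rel_left (m : JoinPoint D) : IsClosed {g | (pointContext D).R g m} := by
  -- The contrapositive puts the hypothesis on the fixed m, leaving an intersection of closed
  -- coordinate conditions on g.
  have h : IsClosed {g : MeetPoint D | ∀ z, m.1 z = false → g.1 z = false} :=
    isClosed_forall fun z => isClosed_forall fun _ => isClosed_eq
      ((continuous_apply z).comp continuous_subtype_val) continuous_const
  have h' : {g : MeetPoint D | ∀ z, g.1 z = true → m.1 z = true} =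
      {g | ∀ z, m.1 z = false → g.1 z = false} := by
    ext g
    refine forall_congr' fun z => ?_
    cases g.1 z <;> cases m.1 z <;> simp
  exact h'.symm ▸ h

theorem isStoneContext_pointContext : IsStoneContext (pointContext D) where
  stoneG := isStoneSpace_meetPoint
  stoneM := isStoneSpace_joinPoint
  continuous := by
    have : CompactSpace (pointContext D).M := isStoneSpace_joinPoint.1
    have : TotallySeparatedSpace (pointContext D).M := isStoneSpace_joinPoint.totallySeparatedSpace
    refine relContinuous_of_isClopen isClosed_rel_right fun B hB => ?_
    obtain ⟨x, rfl⟩ := exists_intentOf_eq hB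
    have := isClopen_extentOf (x ⊔ x)
    rw [← diamond_intentOf] at this
    exact this
  continuous_conv := by
    have : CompactSpace (pointContext D).G := isStoneSpace_meetPoint.1
    have : TotallySeparatedSpace (pointContext D).G := isStoneSpace_meetPoint.totallySeparatedSpace
    refine relContinuous_of_isClopen isClosed_rel_left fun A hA => ?_
    -- The m related to some point of A form the complement of (Aᶜ)^■, which is clopen once Aᶜ is
    -- written as an extent.
    obtain ⟨x, hx⟩ := exists_extentOf_eq hA.compl
    have h1 := (pointContext D).blackBox_eq (extentOf x)
    rw [blackBox_extentOf, hx, compl_compl] at h1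
    rw [← compl_compl {m | _}, ← h1]
    exact (isClopen_intentOf _).compl
  rel_of_semiconcepts g m h z hz := by
    by_contra hm
    -- If g is true and m false at z, the semiconcept generated by `intentOf z` contains m in its
    -- intent. Its extent `extentOf (z ⊔ z)` cannot contain g.
    have h1 : g ∈ extentOf (z ⊔ z) := h (extentOf (z ⊔ z)) (intentOf z)
      ⟨Or.inr (diamond_intentOf z), isClopen_extentOf _, isClopen_intentOf _⟩
      (Bool.eq_false_of_not_eq_true hm)
    exact Bool.noConfusion ((g.map_sup_self_of_eq_true hz).symm.trans h1)

variable (D) in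
/-- The Stone context of the points of a double Boolean algebra. -/
def stoneContext : Scxt.{u} := ⟨pointContext D, isStoneContext_pointContext⟩

/-- The representation of a double Boolean algebra by protoconcepts. -/
def protoconceptOf (x : D) : Protoconcept (stoneContext D) where
  extent := extentOf x
  intent := intentOf x
  isClopen_extent := isClopen_extentOf x
  isClopen_intent := isClopen_intentOf x
  proto := by
    change (pointContext D).diamond ((pointContext D).blackBox (extentOf x)) =
      (pointContext D).diamond (intentOf x)
    -- The two sides become the extents of (x ⊓ x) ⊔ (x ⊓ x) and of x ⊔ x, which agree by axiom
    -- (12).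
    rw [blackBox_extentOf, diamond_intentOf, diamond_intentOf, ax12, extentOf_inf_self]

lemma isDBAHom_protoconceptOf : IsDBAHom (protoconceptOf (D := D)) where
  map_inf a b := Protoconcept.ext (extentOf_inf a b) (Eq.symm <|
    (congrArg (pointContext D).blackBox (extentOf_inf a b).symm).trans <|
      (blackBox_extentOf _).trans (congrArg _ (inf_mem_meetPart a b)))
  map_sup a b := Protoconcept.ext (Eq.symm <|
    (congrArg (pointContext D).diamond (intentOf_sup a b).symm).trans <|
      (diamond_intentOf _).trans (congrArg _ (sup_mem_joinPart a b))) (intentOf_sup a b)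
  map_compl a := Protoconcept.ext (extentOf_compl a) (Eq.symm <|
    (congrArg (pointContext D).blackBox (extentOf_compl a).symm).trans <|
      (blackBox_extentOf _).trans (congrArg _ (compl_mem_meetPart a)))
  map_hnot a := Protoconcept.ext (Eq.symm <|
    (congrArg (pointContext D).diamond (intentOf_hnot a).symm).trans <|
      (diamond_intentOf _).trans (congrArg _ (compl_mem_meetPart (D := Dual D) a)))
    (intentOf_hnot a)
  map_top := Protoconcept.ext extentOf_top intentOf_top
  map_bot := Protoconcept.ext extentOf_bot intentOf_bot

/-- Equal images force x ⊓ x = y ⊓ y and x ⊔ x = y ⊔ y. These give x ⊑ y ⊑ x, so antisymmetry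
finishes. -/
lemma protoconceptOf_injective (hD : IsContextual D) :
    Function.Injective (protoconceptOf (D := D)) := fun x y hxy => by
  have h1 : x ⊓ x = y ⊓ y := inf_self_eq_of_extentOf_eq (congrArg Protoconcept.extent hxy)
  have h2 : x ⊔ x = y ⊔ y := sup_self_eq_of_intentOf_eq (congrArg Protoconcept.intent hxy)
  have h3 : x ⊓ y = x ⊓ x := by rw [← inf_inf_self_right, ← h1, inf_inf_self_right]
  have h4 : x ⊔ y = x ⊔ x := by
    rw [← ax1b, ax2b, h2, ax2b y, ax1b]
  exact hD.antisymm x y ⟨h3, h4.trans h2⟩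
    ⟨(ax2a y x).trans (h3.trans h1), (ax2b y x).trans h4⟩

lemma protoconceptOf_surjective (hD : IsFullyContextual D) :
    Function.Surjective (protoconceptOf (D := D)) := fun z => by
  obtain ⟨a, ha⟩ := exists_extentOf_eq z.isClopen_extent
  obtain ⟨b, hb⟩ := exists_intentOf_eq z.isClopen_intent
  have hp : (pointContext D).diamond ((pointContext D).blackBox z.extent) =
    (pointContext D).diamond z.intent := z.proto
  rw [← ha, ← hb, blackBox_extentOf, diamond_intentOf, diamond_intentOf] at hp
  have h1 := inf_self_eq_of_extentOf_eq hp
  -- Axiom (12) shows (a ⊓ a) ⊔ (a ⊓ a) to be idempotent for ⊓, so the protoconcept equation becomes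
  -- exactly the gluing condition for a ⊓ a and b ⊔ b.
  rw [ax12 a, inf_mem_meetPart, ← ax12 a] at h1
  obtain ⟨c, ⟨hca, hcb⟩, -⟩ := hD.2 (a ⊓ a) (b ⊔ b) (inf_mem_meetPart a a)
    (sup_mem_joinPart b b) h1
  refine ⟨c, Protoconcept.ext ?_ ?_⟩
  · change extentOf c = z.extent
    rw [← extentOf_inf_self, hca, extentOf_inf_self, ha]
  · change intentOf c = z.intent
    rw [← intentOf_sup_self, hcb, intentOf_sup_self, hb]

/-- A fully contextual double Boolean algebra is isomorphic to the algebra of protoconcepts of its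
Stone context. -/
def protoconceptIso (hD : IsFullyContextual D) : DBAIso D (Protoconcept (stoneContext D)) where
  toFun := protoconceptOf
  isHom := isDBAHom_protoconceptOf
  bijective := ⟨protoconceptOf_injective hD.1, protoconceptOf_surjective hD⟩

end Context

lemma DBAIso.trans_symm {D E : Type u} [DoubleBooleanAlgebra D] [DoubleBooleanAlgebra E]
    (h : DBAIso D E) : h.trans h.symm = DBAIso.refl D :=
  DBAIso.ext (funext h.symm_apply_apply)

lemma DBAIso.symm_trans {D E : Type u} [DoubleBooleanAlgebra D] [DoubleBooleanAlgebra E]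
    (h : DBAIso D E) : h.symm.trans h = DBAIso.refl E :=
  DBAIso.ext (funext h.apply_symm_apply)

/-- A dBa isomorphism as an isomorphism of the category of fully contextual algebras. -/
noncomputable def DBAIso.toIso {D E : FCDBA.{u}} (h : DBAIso D.carrier E.carrier) : D ≅ E where
  hom := h
  inv := h.symm
  hom_inv_id := h.trans_symm
  inv_hom_id := h.symm_trans

instance : algebraFunctor.{u}.EssSurj where
  mem_essImage D := ⟨stoneContext D.unop.carrier,
    ⟨(DBAIso.toIso (D := D.unop) (E := (stoneContext D.unop.carrier).algebra)
      (protoconceptIso D.unop.fullyContextual)).op⟩⟩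

instance : algebraFunctor.{u}.IsEquivalence where

end DBA

theorem mainTheorem5 : Nonempty (DBA.FCDBA.{u}ᵒᵖ ≌ DBA.Scxt.{u}) :=
  ⟨DBA.algebraFunctor.{u}.asEquivalence.symm⟩
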